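/- **Theorem (Holm).** Let $R$ be a commutative artinian ring and let $A$ be an artin $R$-algebra, that is, an associative unital $R$-algebra which is finitely generated as an $R$-module. Then $$\mathrm{Fin.dim}\,A=\mathrm{Fin.GP.dim}\,A\qquad\text{and}\qquad \mathrm{fin.dim}\,A=\mathrm{fin.Gp.dim}\,A .$$ Here modules are left $A$-modules, not necessarily finitely generated unless stated otherwise, and the notation is as follows. * An acyclic complex $P^\bullet=(P^n)_{n\in\mathbb Z}$ of projective modules is *totally acyclic* if $\mathrm{Hom}_A(P^\bullet,Q)$ is acyclic for every projective module $Q$. A module is *Gorenstein-projective* if it is isomorphic to the zeroth cocycle module $Z^0(P^\bullet)$ of a totally acyclic complex $P^\bullet$. * A *proper Gorenstein-projective resolution* of a module $M$ is an acyclic complex $\cdots\to G_2\to G_1\to G_0\to M\to 0$ with every $G_i$ Gorenstein-projective that remains acyclic under $\mathrm{Hom}_A(G,-)$ for every Gorenstein-projective module $G$. With $G_\bullet$ the complex $\cdots\to G_2\to G_1\to G_0$, one puts $\mathrm{Ext}^n_{\mathrm{GP}}(M,N)=H^n(\mathrm{Hom}_A(G_\bullet,N))$ for $n\ge 0$; every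 module over an artin algebra has such a resolution, and these groups do not depend on its choice. * $\mathrm{GP.dim}\,M=\sup\{n\ge 0 \mid \mathrm{Ext}^n_{\mathrm{GP}}(M,N)\neq 0 \text{ for some module } N\}$. * $\mathrm{Fin.GP.dim}\,A$ (resp. $\mathrm{fin.Gp.dim}\,A$) is the supremum of $\mathrm{GP.dim}\,M$ over all modules (resp. all finitely generated modules) $M$ with $\mathrm{GP.dim}\,M<\infty$. * $\mathrm{Fin.dim}\,A$ (resp. $\mathrm{fin.dim}\,A$) is the supremum of the projective dimensions of all modules (resp. all finitely generated modules) of finite projective dimension. All suprema are taken in $\{-\infty\}\cup\mathbb N\cup\{\infty\}$, with $\sup\emptyset=-\infty$; the zero module has dimension $-\infty$. -/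

import Mathlib

universe u v

noncomputable section GorensteinDefs

open CategoryTheory

namespace Gorenstein

/-- The Hom complex `Hom_C(X, N)` of abelian groups, for a complex `X` and an object `N`. -/
def homFromComplex {C : Type u} [Category.{v} C] [Preadditive C] {ι : Type*}
    {c : ComplexShape ι} (X : HomologicalComplex C c) (N : C) :
    HomologicalComplex AddCommGrpCat.{v} c.symm :=
  ((preadditiveYoneda.obj N).mapHomologicalComplex c.symm).obj X.op

/-- The Hom complex `Hom_C(G, X)` of abelian groups, for an object `G` and a complex `X`. -/
def homToComplex {C : Type u} [Category.{v} C] [Preadditive C] {ι : Type*}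
    {c : ComplexShape ι} (G : C) (X : HomologicalComplex C c) :
    HomologicalComplex AddCommGrpCat.{v} c :=
  ((preadditiveCoyoneda.obj (Opposite.op G)).mapHomologicalComplex c).obj X

variable {A : Type v} [Ring A]

/-- A complex `P` of `A`-modules, indexed by `ℤ`, is totally acyclic if its terms are projective,
it is acyclic, and `Hom_A(P, Q)` is acyclic for every projective module `Q`. -/
structure IsTotallyAcyclic (P : CochainComplex (ModuleCat.{v} A) ℤ) : Prop where
  projective : ∀ n : ℤ, Projective (P.X n)
  acyclic : P.Acyclic
  hom_acyclic : ∀ Q : ModuleCat.{v} A, Projective Q → (homFromComplex P Q).Acyclic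

/-- A module, not necessarily finitely generated, is Gorenstein-projective if it is isomorphic
to the zeroth cocycle module of a totally acyclic complex. -/
def IsGorensteinProjective (M : ModuleCat.{v} A) : Prop :=
  ∃ P : CochainComplex (ModuleCat.{v} A) ℤ, IsTotallyAcyclic P ∧ Nonempty (P.cycles 0 ≅ M)

/-- A complex `X` is right GP-acyclic if `Hom_A(G, X)` is acyclic for every
Gorenstein-projective module `G`. -/
def IsRightGPAcyclic {ι : Type*} {c : ComplexShape ι}
    (X : HomologicalComplex (ModuleCat.{v} A) c) : Prop :=
  ∀ G : ModuleCat.{v} A, IsGorensteinProjective G → (homToComplex G X).Acyclic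

/-- A proper Gorenstein-projective resolution `⋯ → G₂ → G₁ → G₀ → M → 0`: the augmented complex
(with `M` in degree `0` and `Gₙ` in degree `n + 1`) is acyclic and right GP-acyclic. -/
structure ProperGPResolution (M : ModuleCat.{v} A) where
  /-- the complex `⋯ → G₂ → G₁ → G₀` -/
  complex : ChainComplex (ModuleCat.{v} A) ℕ
  /-- the augmentation `G₀ → M` -/
  aug : complex.X 0 ⟶ M
  d_aug : complex.d 1 0 ≫ aug = 0
  gorensteinProjective : ∀ n : ℕ, IsGorensteinProjective (complex.X n)
  acyclic : (complex.augment aug d_aug).Acyclic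
  proper : IsRightGPAcyclic (complex.augment aug d_aug)

/-- The `n`-th GP-extension group `Ext_GP^n(M, N) = Hⁿ(Hom_A(G, N))`, computed with a proper
Gorenstein-projective resolution `G` of `M`. -/
def gpExt {M : ModuleCat.{v} A} (G : ProperGPResolution M) (N : ModuleCat.{v} A) (n : ℕ) :
    AddCommGrpCat.{v} :=
  (homFromComplex G.complex N).homology n

/-- The Gorenstein-projective dimension `sup {n | Ext_GP^n(M, -) ≠ 0}`. By the comparison theorem
`Ext_GP` does not depend on the proper resolution. The zero module has dimension `⊥`, as it has
for Mathlib's projective dimension. -/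
def gpDim (M : ModuleCat.{v} A) : WithBot ℕ∞ :=
  sSup {d | ∃ n : ℕ, d = n ∧
    ∃ (G : ProperGPResolution M) (N : ModuleCat.{v} A), Nontrivial (gpExt G N n)}

variable (A)

/-- The large finitistic dimension of `A`. -/
def bigFinDim : WithBot ℕ∞ :=
  ⨆ (M : ModuleCat.{v} A) (_ : projectiveDimension M < ⊤), projectiveDimension M

/-- The small finitistic dimension of `A`. -/
def smallFinDim : WithBot ℕ∞ :=
  ⨆ (M : ModuleCat.{v} A) (_ : Module.Finite A M) (_ : projectiveDimension M < ⊤),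
    projectiveDimension M

/-- The large finitistic Gorenstein-projective dimension of `A`. -/
def bigFinGPDim : WithBot ℕ∞ :=
  ⨆ (M : ModuleCat.{v} A) (_ : gpDim M < ⊤), gpDim M

/-- The small finitistic Gorenstein-projective dimension of `A`. -/
def smallFinGPDim : WithBot ℕ∞ :=
  ⨆ (M : ModuleCat.{v} A) (_ : Module.Finite A M) (_ : gpDim M < ⊤), gpDim M

end Gorenstein

end GorensteinDefs

/-!
A module `M` with a proper Gorenstein-projective resolution satisfies `GP.dim M < n` if and only if
it has a hull: it embeds in a module `L` with `pd L < n` and Gorenstein-projective cokernel.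
Gorenstein-projective modules have no extensions by modules of finite projective dimension, so if
`pd M < ∞`, then the embedding splits and `GP.dim M = pd M`. In general, an `M` with `GP.dim M = n`
has a hull `L` with `pd L = n`: were `pd L < n`, then `L` would witness `GP.dim M < n`.

Hulls are built by induction along syzygies, starting from the embedding of a Gorenstein-projective
module in a projective one. If `M` is finitely generated over a left and right noetherian ring `A`,
then so is its dual, as a right module; a finite generating set of the dual gives `M → Aᵏ` through
which all maps from `M` to projectives factor. Starting from this embedding, the hulls are finitely
generated.
-/

namespace Gorenstein

open CategoryTheory Limits Abelian ZeroObject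

universe w

section Extensions

variable {C : Type*} [Category* C] [Abelian C] {X Y Z W Q K L M P D : C}

/-- `Y` is an extension of `Z` by `X`: there is a short exact sequence
`0 ⟶ X ⟶ Y ⟶ Z ⟶ 0`. -/
def IsExtension (X Y Z : C) : Prop :=
  ∃ (f : X ⟶ Y) (g : Y ⟶ Z) (w : f ≫ g = 0), (ShortComplex.mk f g w).ShortExact

theorem isExtension_of_shortExact {S : ShortComplex C} (hS : S.ShortExact) :
    IsExtension S.X₁ S.X₂ S.X₃ :=
  ⟨S.f, S.g, S.zero, hS⟩

theorem isExtension_cokernel (f : X ⟶ Y) [Mono f] : IsExtension X Y (cokernel f) :=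
  ⟨f, cokernel.π f, cokernel.condition f,
    { exact := ShortComplex.exact_of_g_is_cokernel _ (cokernelIsCokernel f) }⟩

theorem isExtension_kernel (g : Y ⟶ Z) [Epi g] : IsExtension (kernel g) Y Z :=
  ⟨kernel.ι g, g, kernel.condition g,
    { exact := ShortComplex.exact_of_f_is_kernel _ (kernelIsKernel g) }⟩

theorem isExtension_biprod (X Y : C) : IsExtension X (X ⊞ Y) Y :=
  isExtension_of_shortExact (ShortComplex.Splitting.ofHasBinaryBiproduct X Y).shortExact

theorem isExtension_of_isZero (X : C) (hZ : IsZero Z) : IsExtension X X Z :=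
  ⟨𝟙 X, 0, comp_zero, { exact := (ShortComplex.exact_iff_epi _ rfl).2 inferInstance
                        epi_g := ⟨fun _ _ _ => hZ.eq_of_src _ _⟩ }⟩

theorem IsExtension.op (h : IsExtension X Y Z) :
    IsExtension (Opposite.op Z) (Opposite.op Y) (Opposite.op X) := by
  obtain ⟨_, _, _, h⟩ := h
  exact isExtension_of_shortExact h.op

theorem IsExtension.unop {X Y Z : Cᵒᵖ} (h : IsExtension X Y Z) :
    IsExtension Z.unop Y.unop X.unop := by
  obtain ⟨_, _, _, h⟩ := h
  exact isExtension_of_shortExact h.unop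

theorem IsExtension.of_iso {X' Y' Z' : C} (h : IsExtension X Y Z) (eX : X ≅ X') (eY : Y ≅ Y')
    (eZ : Z ≅ Z') : IsExtension X' Y' Z' := by
  obtain ⟨f, g, w, h⟩ := h
  exact ⟨eX.inv ≫ f ≫ eY.hom, eY.inv ≫ g ≫ eZ.hom, by simp [reassoc_of% w],
    ShortComplex.shortExact_of_iso (ShortComplex.isoMk eX eY eZ) h⟩

theorem IsExtension.exists_mono (h : IsExtension X Y Z) :
    ∃ f : X ⟶ Y, Mono f ∧ Nonempty (cokernel f ≅ Z) := by
  obtain ⟨f, g, w, h⟩ := h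
  exact ⟨f, h.mono_f, ⟨(cokernelIsCokernel f).coconePointUniqueUpToIso h.gIsCokernel⟩⟩

theorem IsExtension.exists_epi (h : IsExtension X Y Z) :
    ∃ g : Y ⟶ Z, Epi g ∧ Nonempty (kernel g ≅ X) := by
  obtain ⟨f, g, w, h⟩ := h
  exact ⟨g, h.epi_g, ⟨(kernelIsKernel g).conePointUniqueUpToIso h.fIsKernel⟩⟩

theorem isExtension_cokernel_of_isPushout {t : X ⟶ Y} {l : X ⟶ Q} {r : Y ⟶ W} {b : Q ⟶ W}
    (sq : IsPushout t l r b) [Mono t] : IsExtension Q W (cokernel t) := by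
  have : Mono b := (MorphismProperty.monomorphisms C).of_isPushout sq.flip ‹Mono t›
  have := isIso_cokernel_map_of_isPushout sq
  exact (isExtension_cokernel b).of_iso (.refl _) (.refl _)
    (asIso (cokernel.map _ _ _ _ sq.w)).symm

theorem isExtension_kernel_of_isPushout {t : X ⟶ Y} {l : X ⟶ Q} {r : Y ⟶ W} {b : Q ⟶ W}
    (sq : IsPushout t l r b) [Epi t] [Mono l] : IsExtension (kernel t) Q W := by
  have : Epi b := (MorphismProperty.epimorphisms C).of_isPushout sq.flip ‹Epi t›
  have := epi_kernel_map_of_isPushout sq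
  have : Mono (kernel.map _ _ _ _ sq.w) :=
    mono_of_mono_fac (kernel.lift_ι b (kernel.ι t ≫ l) _)
  have := isIso_of_mono_of_epi (kernel.map _ _ _ _ sq.w)
  exact (isExtension_kernel b).of_iso (asIso (kernel.map _ _ _ _ sq.w)).symm (.refl _) (.refl _)

theorem IsExtension.exists_pushout (h₁ : IsExtension X Y Z) (h₂ : IsExtension X Q D) :
    ∃ W, IsExtension Q W Z ∧ IsExtension Y W D := by
  obtain ⟨f₁, _, ⟨e₁⟩⟩ := h₁.exists_mono
  obtain ⟨f₂, _, ⟨e₂⟩⟩ := h₂.exists_mono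
  have sq := IsPushout.of_hasPushout f₁ f₂
  exact ⟨_, (isExtension_cokernel_of_isPushout sq).of_iso (.refl _) (.refl _) e₁,
    (isExtension_cokernel_of_isPushout sq.flip).of_iso (.refl _) (.refl _) e₂⟩

theorem IsExtension.exists_pullback (h₁ : IsExtension X Y Z) (h₂ : IsExtension K Q Z) :
    ∃ W, IsExtension K W Y ∧ IsExtension X W Q :=
  let ⟨_, hQ, hY⟩ := h₁.op.exists_pushout h₂.op
  ⟨_, hY.unop, hQ.unop⟩

theorem IsExtension.exists_quotient (h₁ : IsExtension X Y Z) (h₂ : IsExtension Y Q D) :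
    ∃ L, IsExtension X Q L ∧ IsExtension Z L D := by
  obtain ⟨g, _, ⟨e₁⟩⟩ := h₁.exists_epi
  obtain ⟨f, _, ⟨e₂⟩⟩ := h₂.exists_mono
  have sq := IsPushout.of_hasPushout g f
  exact ⟨_, (isExtension_kernel_of_isPushout sq).of_iso e₁ (.refl _) (.refl _),
    (isExtension_cokernel_of_isPushout sq.flip).of_iso (.refl _) (.refl _) e₂⟩

theorem IsExtension.exists_preimage (h₁ : IsExtension K P L) (h₂ : IsExtension M L D) :
    ∃ G, IsExtension K G M ∧ IsExtension G P D :=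
  let ⟨_, hD, hM⟩ := h₂.op.exists_quotient h₁.op
  ⟨_, hM.unop, hD.unop⟩

theorem isPushout_inr_biprod_map_id (f : X ⟶ Y) (W : C) :
    IsPushout f biprod.inr biprod.inr (biprod.map (𝟙 W) f) :=
  .of_isColimit' ⟨by simp⟩ <| PushoutCocone.IsColimit.mk _
    (fun s => biprod.desc (biprod.inl ≫ s.inr) s.inl)
    (fun s => by simp)
    (fun s => by ext <;> simp [s.condition])
    (fun s m h₁ h₂ => by ext <;> simp [← h₁, ← h₂])

theorem IsExtension.biprod_left (h : IsExtension X Y Z) (W : C) :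
    IsExtension (W ⊞ X) (W ⊞ Y) Z := by
  obtain ⟨f, _, ⟨e⟩⟩ := h.exists_mono
  exact (isExtension_cokernel_of_isPushout (isPushout_inr_biprod_map_id f W)).of_iso
    (.refl _) (.refl _) e

theorem IsExtension.hasProjectiveDimensionLT_left (h : IsExtension X Y Z) (n : ℕ)
    [HasProjectiveDimensionLT Y n] [HasProjectiveDimensionLT Z (n + 1)] :
    HasProjectiveDimensionLT X n :=
  let ⟨_, _, _, hS⟩ := h
  hS.hasProjectiveDimensionLT_X₁ n ‹_› ‹_›

theorem IsExtension.hasProjectiveDimensionLT_right (h : IsExtension X Y Z) (n : ℕ)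
    [HasProjectiveDimensionLT X n] [HasProjectiveDimensionLT Y (n + 1)] :
    HasProjectiveDimensionLT Z (n + 1) :=
  let ⟨_, _, _, hS⟩ := h
  hS.hasProjectiveDimensionLT_X₃ n ‹_› ‹_›

theorem IsExtension.prop_middle (h : IsExtension X Y Z) (𝓕 : ObjectProperty C)
    [𝓕.IsClosedUnderExtensions] (hX : 𝓕 X) (hZ : 𝓕 Z) : 𝓕 Y :=
  let ⟨_, _, _, hS⟩ := h
  𝓕.prop_X₂_of_shortExact hS hX hZ

theorem IsExtension.prop_left (h : IsExtension X Y Z) (𝓕 : ObjectProperty C)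
    [𝓕.IsClosedUnderSubobjects] (hY : 𝓕 Y) : 𝓕 X :=
  let ⟨_, _, _, hS⟩ := h
  𝓕.prop_X₁_of_shortExact hS hY

theorem IsExtension.prop_right (h : IsExtension X Y Z) (𝓕 : ObjectProperty C)
    [𝓕.IsClosedUnderQuotients] (hY : 𝓕 Y) : 𝓕 Z :=
  let ⟨_, _, _, hS⟩ := h
  𝓕.prop_X₃_of_shortExact hS hY

theorem exists_isExtension_projective [EnoughProjectives C] (X : C) :
    ∃ K P, Projective P ∧ IsExtension K P X :=
  ⟨_, _, Projective.projective_over X, isExtension_kernel (Projective.π X)⟩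

end Extensions

section ExtVanishing

variable {C : Type*} [Category* C] [Abelian C] [HasExt.{w} C] {X Y Z N : C}

theorem IsExtension.subsingleton_ext_into_right (h : IsExtension X Y Z) (N : C) (i : ℕ)
    [Subsingleton (Ext N Y i)] [Subsingleton (Ext N X (i + 1))] :
    Subsingleton (Ext N Z i) := by
  obtain ⟨f, g, w, h⟩ := h
  refine subsingleton_of_forall_eq 0 fun e => ?_
  obtain ⟨x, rfl⟩ := Ext.covariant_sequence_exact₃ N h e rfl (Subsingleton.elim _ _)
  rw [Subsingleton.elim x 0, Ext.zero_comp]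

theorem IsExtension.subsingleton_ext_middle (h : IsExtension X Y Z) (N : C) (i : ℕ)
    [Subsingleton (Ext X N i)] [Subsingleton (Ext Z N i)] :
    Subsingleton (Ext Y N i) := by
  obtain ⟨f, g, w, h⟩ := h
  refine subsingleton_of_forall_eq 0 fun e => ?_
  obtain ⟨x, rfl⟩ := Ext.contravariant_sequence_exact₂ h N e (Subsingleton.elim _ _)
  rw [Subsingleton.elim x 0, Ext.comp_zero]

theorem IsExtension.subsingleton_ext_left (h : IsExtension X Y Z) (N : C) (i : ℕ)
    [Subsingleton (Ext Y N i)] [Subsingleton (Ext Z N (i + 1))] :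
    Subsingleton (Ext X N i) := by
  obtain ⟨f, g, w, h⟩ := h
  refine subsingleton_of_forall_eq 0 fun e => ?_
  obtain ⟨x, rfl⟩ := Ext.contravariant_sequence_exact₁ h N e (add_comm 1 i)
    (Subsingleton.elim _ _)
  rw [Subsingleton.elim x 0, Ext.comp_zero]

theorem IsExtension.subsingleton_ext_right (h : IsExtension X Y Z) (N : C) (i : ℕ)
    [Subsingleton (Ext X N i)] [Subsingleton (Ext Y N (i + 1))] :
    Subsingleton (Ext Z N (i + 1)) := by
  obtain ⟨f, g, w, h⟩ := h
  refine subsingleton_of_forall_eq 0 fun e => ?_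
  obtain ⟨x, rfl⟩ := Ext.contravariant_sequence_exact₃ h N e
    (Subsingleton.elim _ _) (add_comm 1 i)
  rw [Subsingleton.elim x 0, Ext.comp_zero]

theorem subsingleton_ext_of_retract (r : Retract X Y) (N : C) (i : ℕ)
    [Subsingleton (Ext Y N i)] : Subsingleton (Ext X N i) := by
  refine subsingleton_of_forall_eq 0 fun e => ?_
  rw [← e.mk₀_id_comp, ← r.retract, ← Ext.mk₀_comp_mk₀, Ext.comp_assoc_of_second_deg_zero,
    Subsingleton.elim ((Ext.mk₀ r.r).comp e _) 0, Ext.comp_zero]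

theorem exists_extension_of_subsingleton_ext {S : ShortComplex C} (hS : S.ShortExact)
    [Subsingleton (Ext S.X₃ N 1)] (φ : S.X₁ ⟶ N) : ∃ ψ : S.X₂ ⟶ N, S.f ≫ ψ = φ := by
  obtain ⟨x, hx⟩ := Ext.contravariant_sequence_exact₁ hS N (Ext.mk₀ φ) (add_zero 1)
    (Subsingleton.elim _ _)
  obtain ⟨ψ, rfl⟩ := (Ext.mk₀_bijective _ _).2 x
  exact ⟨ψ, (Ext.mk₀_bijective _ _).1 (by rw [← hx, Ext.mk₀_comp_mk₀])⟩

theorem exists_lift_of_subsingleton_ext {S : ShortComplex C} (hS : S.ShortExact)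
    [Subsingleton (Ext N S.X₁ 1)] (φ : N ⟶ S.X₃) : ∃ ψ : N ⟶ S.X₂, ψ ≫ S.g = φ := by
  obtain ⟨x, hx⟩ := Ext.covariant_sequence_exact₃ N hS (Ext.mk₀ φ) (zero_add 1)
    (Subsingleton.elim _ _)
  obtain ⟨ψ, rfl⟩ := (Ext.mk₀_bijective _ _).2 x
  exact ⟨ψ, (Ext.mk₀_bijective _ _).1 (by rw [← hx, Ext.mk₀_comp_mk₀])⟩

theorem subsingleton_ext_one_of_forall_exists_extension {S : ShortComplex C} (hS : S.ShortExact)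
    [Projective S.X₂] (hN : ∀ φ : S.X₁ ⟶ N, ∃ ψ : S.X₂ ⟶ N, S.f ≫ ψ = φ) :
    Subsingleton (Ext S.X₃ N 1) := by
  refine subsingleton_of_forall_eq 0 fun e => ?_
  obtain ⟨x, rfl⟩ := Ext.contravariant_sequence_exact₃ hS N e
    (Ext.eq_zero_of_projective _) (add_comm 1 0)
  obtain ⟨φ, rfl⟩ := (Ext.mk₀_bijective _ _).2 x
  obtain ⟨ψ, rfl⟩ := hN φ
  rw [← Ext.mk₀_comp_mk₀, hS.extClass_comp_assoc]

theorem IsExtension.nonempty_iso_biprod (h : IsExtension X Y Z) [Subsingleton (Ext Z X 1)] :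
    Nonempty (Y ≅ X ⊞ Z) := by
  obtain ⟨f, g, w, h⟩ := h
  obtain ⟨r, hr⟩ := exists_extension_of_subsingleton_ext h (𝟙 _)
  have := h.epi_g
  exact ⟨(ShortComplex.Splitting.ofExactOfRetraction _ h.exact r hr this).isoBinaryBiproduct⟩

end ExtVanishing

section GorensteinProjective

variable {C : Type*} [Category* C] [Abelian C] [HasExt.{w} C] {X Y P G : C}

/-- All positive `Ext` groups from `M` to projective objects vanish. -/
def ExtProjectivesVanish (M : C) : Prop :=
  ∀ (Q : C) [Projective Q] (i : ℕ), Subsingleton (Ext M Q (i + 1))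

/-- A class of objects without positive extensions by projective objects, each of whose members
embeds in a projective object with cokernel in the class. -/
def IsCoresolving (𝒳 : ObjectProperty C) : Prop :=
  ∀ M, 𝒳 M → ExtProjectivesVanish M ∧ ∃ P N, Projective P ∧ IsExtension M P N ∧ 𝒳 N

/-- The Gorenstein-projective objects of an abelian category, defined coinductively as the largest
coresolving class. For modules this is equivalent to being a cocycle module of a totally acyclic
complex, see `isGorensteinProjective_iff`. -/
def gorensteinProjective : ObjectProperty C :=
  fun M => ∃ 𝒳 : ObjectProperty C, IsCoresolving 𝒳 ∧ 𝒳 M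

theorem IsCoresolving.le_gorensteinProjective {𝒳 : ObjectProperty C} (h : IsCoresolving 𝒳) :
    𝒳 ≤ gorensteinProjective :=
  fun _ hM => ⟨𝒳, h, hM⟩

theorem extProjectivesVanish_of_projective [Projective P] : ExtProjectivesVanish P :=
  fun Q _ i => Ext.subsingleton_of_projective P Q i

theorem gorensteinProjective.extProjectivesVanish (hG : gorensteinProjective G) :
    ExtProjectivesVanish G :=
  let ⟨_, h𝒳, hG⟩ := hG
  (h𝒳 G hG).1

theorem gorensteinProjective.exists_isExtension (hG : gorensteinProjective G) :
    ∃ P N, Projective P ∧ IsExtension G P N ∧ gorensteinProjective N :=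
  let ⟨𝒳, h𝒳, hG⟩ := hG
  let ⟨P, N, hP, h, hN⟩ := (h𝒳 G hG).2
  ⟨P, N, hP, h, 𝒳, h𝒳, hN⟩

theorem ExtProjectivesVanish.gorensteinProjective_of_isExtension (hX : ExtProjectivesVanish X)
    [Projective P] (h : IsExtension X P Y) (hY : gorensteinProjective Y) :
    gorensteinProjective X := by
  refine IsCoresolving.le_gorensteinProjective (𝒳 := fun M => gorensteinProjective M ∨ M = X) ?_ X
    (.inr rfl)
  rintro M (hM | rfl)
  · obtain ⟨P, N, hP, hPN, hN⟩ := hM.exists_isExtension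
    exact ⟨hM.extProjectivesVanish, P, N, hP, hPN, .inl hN⟩
  · exact ⟨hX, P, Y, ‹_›, h, .inl hY⟩

theorem gorensteinProjective_of_projective (P : C) [Projective P] : gorensteinProjective P := by
  refine IsCoresolving.le_gorensteinProjective (𝒳 := Projective) (fun P hP => ?_) P ‹_›
  exact ⟨extProjectivesVanish_of_projective, P ⊞ P, P, inferInstance, isExtension_biprod P P, hP⟩

theorem gorensteinProjective.of_isExtension (hY : gorensteinProjective Y) [Projective P]
    (h : IsExtension X P Y) : gorensteinProjective X := by
  refine ExtProjectivesVanish.gorensteinProjective_of_isExtension (fun Q _ i => ?_) h hY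
  have := hY.extProjectivesVanish Q (i + 1)
  have := Ext.subsingleton_of_projective P Q i
  exact h.subsingleton_ext_left Q (i + 1)

instance : (gorensteinProjective (C := C)).IsClosedUnderExtensions where
  prop_X₂_of_shortExact {S} hS h₁ h₃ := by
    let 𝒳 : ObjectProperty C := fun Y =>
      ∃ X Z, gorensteinProjective X ∧ gorensteinProjective Z ∧ IsExtension X Y Z
    suffices IsCoresolving 𝒳 from
      this.le_gorensteinProjective _ ⟨_, _, h₁, h₃, isExtension_of_shortExact hS⟩
    rintro Y ⟨X, Z, hX, hZ, h⟩
    refine ⟨fun Q _ i => ?_, ?_⟩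
    · have := hX.extProjectivesVanish Q i
      have := hZ.extProjectivesVanish Q i
      exact h.subsingleton_ext_middle Q _
    · obtain ⟨P, X', hP, hPX, hX'⟩ := hX.exists_isExtension
      obtain ⟨Q, Z', hQ, hQZ, hZ'⟩ := hZ.exists_isExtension
      obtain ⟨W, hPW, hYW⟩ := h.exists_pushout hPX
      have := hZ.extProjectivesVanish P 0
      obtain ⟨e⟩ := hPW.nonempty_iso_biprod
      obtain ⟨L, hYL, hL⟩ :=
        hYW.exists_quotient ((hQZ.biprod_left P).of_iso e.symm (.refl _) (.refl _))
      exact ⟨P ⊞ Q, L, inferInstance, hYL, X', Z', hX', hZ', hL⟩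

instance : (gorensteinProjective (C := C)).IsClosedUnderIsomorphisms where
  of_iso {X _} e hX :=
    ((isExtension_of_isZero X (isZero_zero C)).of_iso (.refl _) e (.refl _)).prop_middle _ hX
      (gorensteinProjective_of_projective 0)

theorem gorensteinProjective_of_biprod (h : gorensteinProjective (X ⊞ Y)) :
    gorensteinProjective X := by
  refine IsCoresolving.le_gorensteinProjective (𝒳 := fun X => ∃ Y, gorensteinProjective (X ⊞ Y))
    ?_ X ⟨Y, h⟩
  rintro X ⟨Y, h⟩
  refine ⟨fun Q _ i => ?_, ?_⟩
  · have := h.extProjectivesVanish Q i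
    exact subsingleton_ext_of_retract ⟨biprod.inl, biprod.fst, by simp⟩ (Y := X ⊞ Y) Q _
  · obtain ⟨P, N, hP, hPN, hN⟩ := h.exists_isExtension
    obtain ⟨L, hXL, hL⟩ := (isExtension_biprod X Y).exists_quotient hPN
    have hXL' : gorensteinProjective (X ⊞ L) := (hL.biprod_left X).prop_middle _ h hN
    exact ⟨P, L, hP, hXL, X, gorensteinProjective.prop_of_iso (biprod.braiding X L) hXL'⟩

theorem gorensteinProjective.cokernel (hX : gorensteinProjective X) [Projective P]
    (h : IsExtension X P Y) (hY : ∀ (Q : C) [Projective Q], Subsingleton (Ext Y Q 1)) :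
    gorensteinProjective Y := by
  obtain ⟨Q, N, hQ, hQN, hN⟩ := hX.exists_isExtension
  obtain ⟨W, hQW, hPW⟩ := h.exists_pushout hQN
  have := hY Q
  obtain ⟨e⟩ := hQW.nonempty_iso_biprod
  have hW := hPW.prop_middle _ (gorensteinProjective_of_projective P) hN
  exact gorensteinProjective_of_biprod (gorensteinProjective.prop_of_iso
    (e ≪≫ biprod.braiding Q Y) hW)

theorem gorensteinProjective.exists_isExtension_of_approximation (hX : gorensteinProjective X)
    [Projective P] (Φ : X ⟶ P)
    (hΦ : ∀ (Q : C) [Projective Q] (φ : X ⟶ Q), ∃ ψ : P ⟶ Q, Φ ≫ ψ = φ) :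
    ∃ N, IsExtension X P N ∧ gorensteinProjective N := by
  obtain ⟨Q, _, _, ⟨f, _, _, hS⟩, _⟩ := hX.exists_isExtension
  obtain ⟨ψ, hψ⟩ := hΦ Q f
  have := hS.mono_f
  have : Mono Φ := mono_of_mono_fac hψ
  have hΦS : (ShortComplex.mk Φ (cokernel.π Φ) (cokernel.condition Φ)).ShortExact :=
    { exact := ShortComplex.exact_of_g_is_cokernel _ (cokernelIsCokernel Φ) }
  exact ⟨_, isExtension_of_shortExact hΦS, hX.cokernel (isExtension_of_shortExact hΦS)
    fun Q _ => subsingleton_ext_one_of_forall_exists_extension hΦS (hΦ Q)⟩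

variable [EnoughProjectives C]

theorem ExtProjectivesVanish.subsingleton_ext (hG : ExtProjectivesVanish G) (n : ℕ) (N : C)
    [HasProjectiveDimensionLT N (n + 1)] (i : ℕ) : Subsingleton (Ext G N (i + 1)) := by
  induction n generalizing N i with
  | zero =>
    have := projective_iff_hasProjectiveDimensionLT_one.2 ‹HasProjectiveDimensionLT N 1›
    exact hG N i
  | succ n ih =>
    obtain ⟨K, P, hP, h⟩ := exists_isExtension_projective N
    have := h.hasProjectiveDimensionLT_left (n + 1)
    have := hG P i
    have := ih K (i + 1)
    exact h.subsingleton_ext_into_right G _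

end GorensteinProjective

section Hulls

variable {C : Type*} [Category* C] [Abelian C] [HasExt.{w} C] {M G K : C}

/-- `M` embeds in an object in `𝓕` of projective dimension less than `n`, with
Gorenstein-projective cokernel. The strict bound makes `n = 0` the case `M = 0`. -/
def HasHull (𝓕 : ObjectProperty C) (n : ℕ) (M : C) : Prop :=
  ∃ L N : C, IsExtension M L N ∧ HasProjectiveDimensionLT L n ∧ gorensteinProjective N ∧ 𝓕 L

variable {𝓕 : ObjectProperty C} {m n : ℕ}

theorem HasHull.mono (h : HasHull 𝓕 m M) (hmn : m ≤ n) : HasHull 𝓕 n M :=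
  let ⟨L, N, hMN, _, hN, hF⟩ := h
  ⟨L, N, hMN, hasProjectiveDimensionLT_of_ge L m n hmn, hN, hF⟩

theorem HasHull.of_iso {M' : C} (h : HasHull 𝓕 n M) (e : M ≅ M') : HasHull 𝓕 n M' :=
  let ⟨L, N, hMN, hLN⟩ := h
  ⟨L, N, hMN.of_iso e (.refl _) (.refl _), hLN⟩

theorem hasHull_of_hasProjectiveDimensionLT [HasProjectiveDimensionLT M n] (hM : 𝓕 M) :
    HasHull 𝓕 n M :=
  ⟨M, 0, isExtension_of_isZero M (isZero_zero C), ‹_›, gorensteinProjective_of_projective 0, hM⟩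

theorem hasHull_zero_iff : HasHull ⊤ 0 M ↔ IsZero M := by
  refine ⟨fun ⟨L, N, ⟨f, _, _, h⟩, hL, _⟩ => ?_, fun h => ?_⟩
  · have := h.mono_f
    exact .of_mono f ((hasProjectiveDimensionLT_zero_iff_isZero L).1 hL)
  · have := (hasProjectiveDimensionLT_zero_iff_isZero M).2 h
    exact hasHull_of_hasProjectiveDimensionLT trivial

theorem hasHull_one_iff : HasHull ⊤ 1 M ↔ gorensteinProjective M := by
  refine ⟨fun ⟨L, N, h, hL, hN, _⟩ => ?_, fun h => ?_⟩
  · have := projective_iff_hasProjectiveDimensionLT_one.2 hL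
    exact hN.of_isExtension h
  · obtain ⟨P, N, hP, hPN, hN⟩ := h.exists_isExtension
    exact ⟨P, N, hPN, inferInstance, hN, trivial⟩

theorem HasHull.of_syzygy [𝓕.IsClosedUnderQuotients] [𝓕.IsClosedUnderExtensions]
    (h𝓕 : ∀ N, 𝓕 N → gorensteinProjective N → HasHull 𝓕 1 N) (h : HasHull 𝓕 n K)
    (hK : IsExtension K G M) (hG : gorensteinProjective G) (hG𝓕 : 𝓕 G) :
    HasHull 𝓕 (n + 1) M := by
  obtain ⟨L', N', hKL, _, hN', hL'⟩ := h
  obtain ⟨W, hLW, hGW⟩ := hK.exists_pushout hKL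
  have hW : 𝓕 W := hGW.prop_middle 𝓕 hG𝓕 (hKL.prop_right 𝓕 hL')
  obtain ⟨Q, N, hWQ, _, hN, hQ⟩ := h𝓕 W hW (hGW.prop_middle _ hG hN')
  obtain ⟨L, hL, hML⟩ := hLW.exists_quotient hWQ
  have := hasProjectiveDimensionLT_of_ge Q 1 (n + 1) (by lia)
  exact ⟨L, N, hML, hL.hasProjectiveDimensionLT_right n, hN, hL.prop_right 𝓕 hQ⟩

variable [EnoughProjectives C]

theorem HasHull.syzygy (h : HasHull 𝓕 (n + 2) M) (hK : IsExtension K G M)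
    (hG : gorensteinProjective G) : HasHull ⊤ (n + 1) K := by
  obtain ⟨L, N, hML, _, hN, -⟩ := h
  obtain ⟨K', P, _, hKP⟩ := exists_isExtension_projective L
  have := hKP.hasProjectiveDimensionLT_left (n + 1)
  obtain ⟨G', hKG', hG'P⟩ := hKP.exists_preimage hML
  obtain ⟨W, hK'W, hKW⟩ := hK.exists_pullback hKG'
  have := hG.extProjectivesVanish.subsingleton_ext n K' 0
  obtain ⟨e⟩ := hK'W.nonempty_iso_biprod
  obtain ⟨Q, D, _, hGQ, hD⟩ := hG.exists_isExtension
  obtain ⟨L', hKL', hL'⟩ :=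
    hKW.exists_quotient ((hGQ.biprod_left K').of_iso e.symm (.refl _) (.refl _))
  have := hasProjectiveDimensionLT_of_ge Q 1 (n + 1) (by lia)
  exact ⟨K' ⊞ Q, L', hKL', inferInstance,
    hL'.prop_middle _ (hN.of_isExtension hG'P) hD, trivial⟩

theorem HasHull.hasProjectiveDimensionLT (h : HasHull 𝓕 n M) (hM : projectiveDimension M < ⊤) :
    HasProjectiveDimensionLT M n := by
  obtain ⟨m, _⟩ := (projectiveDimension_ne_top_iff M).1 hM.ne
  obtain ⟨L, N, hML, _, hN, -⟩ := h
  have := hN.extProjectivesVanish.subsingleton_ext m M 0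
  obtain ⟨e⟩ := hML.nonempty_iso_biprod
  have r : Retract M L := ⟨biprod.inl ≫ e.inv, e.hom ≫ biprod.fst, by simp⟩
  exact r.hasProjectiveDimensionLT n

theorem HasHull.restrict [𝓕.IsClosedUnderSubobjects] [𝓕.IsClosedUnderQuotients]
    [𝓕.IsClosedUnderExtensions] (hproj : ∀ M, 𝓕 M → ∃ K P, Projective P ∧ 𝓕 P ∧ IsExtension K P M)
    (h𝓕 : ∀ N, 𝓕 N → gorensteinProjective N → HasHull 𝓕 1 N) (hM : 𝓕 M) (h : HasHull ⊤ n M) :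
    HasHull 𝓕 n M := by
  induction n using Nat.twoStepInduction generalizing M with
  | zero =>
    have := (hasProjectiveDimensionLT_zero_iff_isZero M).2 (hasHull_zero_iff.1 h)
    exact hasHull_of_hasProjectiveDimensionLT hM
  | one => exact h𝓕 M hM (hasHull_one_iff.1 h)
  | more n _ ih =>
    obtain ⟨K, P, hP, hP𝓕, hK⟩ := hproj M hM
    have hPG := gorensteinProjective_of_projective P
    exact (ih (hK.prop_left 𝓕 hP𝓕) (h.syzygy hK hPG)).of_syzygy h𝓕 hK hPG hP𝓕

end Hulls

section Complexes

open HomologicalComplex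

variable {C : Type*} [Category* C] [Abelian C] {ι : Type*} {c : ComplexShape ι}
  (X : HomologicalComplex C c) (N : C) {i j k : ι}

theorem homFromComplex_exactAt_iff (hi : c.prev j = i) (hk : c.next j = k) :
    (homFromComplex X N).ExactAt j ↔
      ∀ φ : X.X j ⟶ N, X.d i j ≫ φ = 0 → ∃ ψ : X.X k ⟶ N, X.d j k ≫ ψ = φ := by
  rw [exactAt_iff' (homFromComplex X N) k j i hk hi, ShortComplex.ab_exact_iff]
  rfl

theorem homToComplex_exactAt_iff (hi : c.prev j = i) :
    (homToComplex N X).ExactAt j ↔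
      ∀ φ : N ⟶ X.cycles j, ∃ ψ : N ⟶ X.X i, ψ ≫ X.toCycles i j = φ := by
  rw [exactAt_iff' (homToComplex N X) i j _ hi rfl, ShortComplex.ab_exact_iff]
  change (∀ φ : N ⟶ X.X j, φ ≫ X.d j _ = 0 → ∃ ψ : N ⟶ X.X i, ψ ≫ X.d i j = φ) ↔ _
  refine ⟨fun h φ => ?_, fun h φ hφ => ?_⟩
  · obtain ⟨ψ, hψ⟩ := h (φ ≫ X.iCycles j) (by simp)
    exact ⟨ψ, by rw [← cancel_mono (X.iCycles j), Category.assoc, X.toCycles_i, hψ]⟩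
  · obtain ⟨ψ, hψ⟩ := h (X.liftCycles φ _ rfl hφ)
    exact ⟨ψ, by rw [← X.toCycles_i, reassoc_of% hψ, X.liftCycles_i]⟩

variable {X}

theorem exactAt_iff_epi_toCycles (hi : c.prev j = i) :
    X.ExactAt j ↔ Epi (X.toCycles i j) := by
  rw [exactAt_iff' X i j _ hi rfl, ShortComplex.exact_iff_epi_toCycles,
    ← X.toCycles_cyclesIsoSc'_hom i j _ hi rfl]
  exact (MorphismProperty.epimorphisms C).cancel_right_of_respectsIso _ _

theorem shortExact_cycles (hij : c.Rel i j) (hX : X.ExactAt j) :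
    (ShortComplex.mk (X.iCycles i) (X.toCycles i j)
      (by rw [← cancel_mono (X.iCycles j)]; simp)).ShortExact where
  exact := ShortComplex.exact_of_f_is_kernel _ <|
    isKernelOfComp (X.iCycles j) _ (X.cyclesIsKernel i j (c.next_eq' hij)) _ (X.toCycles_i i j)
  epi_g := (exactAt_iff_epi_toCycles (c.prev_eq' hij)).1 hX

theorem homFromComplex_exactAt_iff_cycles (hij : c.Rel i j) (hjk : c.Rel j k)
    (hj : X.ExactAt j) (hk : X.ExactAt k) :
    (homFromComplex X N).ExactAt j ↔
      ∀ χ : X.cycles k ⟶ N, ∃ ψ : X.X k ⟶ N, X.iCycles k ≫ ψ = χ := by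
  have hSj := shortExact_cycles hij hj
  have hSk := shortExact_cycles hjk hk
  have := hSj.epi_g
  have := hSk.epi_g
  rw [homFromComplex_exactAt_iff X N (c.prev_eq' hij) (c.next_eq' hjk)]
  refine ⟨fun h χ => ?_, fun h φ hφ => ?_⟩
  · obtain ⟨ψ, hψ⟩ := h (X.toCycles j k ≫ χ) (by simp)
    exact ⟨ψ, by rw [← cancel_epi (X.toCycles j k), X.toCycles_i_assoc, hψ]⟩
  · have hφ' : X.iCycles j ≫ φ = 0 := by
      rw [← cancel_epi (X.toCycles i j), X.toCycles_i_assoc, hφ, comp_zero]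
    obtain ⟨ψ, hψ⟩ := h (hSk.exact.desc φ hφ')
    exact ⟨ψ, by rw [← X.toCycles_i, Category.assoc, hψ]; exact hSk.exact.g_desc φ hφ'⟩

theorem exists_acyclic_of_isExtension {Z P : ℤ → C}
    (h : ∀ n, IsExtension (Z n) (P n) (Z (n + 1))) :
    ∃ X : CochainComplex C ℤ, X.X = P ∧ X.Acyclic ∧ ∀ n, Nonempty (X.cycles n ≅ Z n) := by
  choose f g w hfg using h
  have := fun n => (hfg n).mono_f
  let X : CochainComplex C ℤ :=
    CochainComplex.of P (fun n => g n ≫ f (n + 1)) (fun n => by simp [reassoc_of% w])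
  have hd (n : ℤ) : X.d n (n + 1) = g n ≫ f (n + 1) := by
    simp [X]
  let e (n : ℤ) : X.cycles n ≅ Z n :=
    (X.cyclesIsKernel n (n + 1) (by simp)).conePointUniqueUpToIso
      (isKernelCompMono (hfg n).fIsKernel (f (n + 1)) (hd n))
  have he (n : ℤ) : (e n).hom ≫ f n = X.iCycles n :=
    IsLimit.conePointUniqueUpToIso_hom_comp _ _ WalkingParallelPair.zero
  refine ⟨X, rfl, fun m => ?_, fun n => ⟨e n⟩⟩
  obtain ⟨n, rfl⟩ : ∃ n, m = n + 1 := ⟨m - 1, by simp⟩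
  have hg : X.toCycles n (n + 1) ≫ (e (n + 1)).hom = g n := by
    rw [← cancel_mono (f (n + 1)), Category.assoc, he, X.toCycles_i, hd]
  have := (hfg n).epi_g
  rw [exactAt_iff_epi_toCycles (i := n) (by simp), (Iso.eq_comp_inv _).2 hg]
  infer_instance

end Complexes

section TotallyAcyclic

variable {A : Type v} [Ring A] {M : ModuleCat.{v} A} {P : CochainComplex (ModuleCat.{v} A) ℤ}

theorem IsTotallyAcyclic.isExtension_cycles (hP : IsTotallyAcyclic P) (n : ℤ) :
    IsExtension (P.cycles n) (P.X n) (P.cycles (n + 1)) :=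
  isExtension_of_shortExact (shortExact_cycles (by simp) (hP.acyclic _))

theorem IsTotallyAcyclic.extProjectivesVanish_cycles (hP : IsTotallyAcyclic P) (n : ℤ) :
    ExtProjectivesVanish (P.cycles n) := by
  intro Q _ i
  obtain ⟨k, rfl⟩ : ∃ k, n = k + 1 := ⟨n - 1, by simp⟩
  induction i generalizing k with
  | zero =>
    have := hP.projective k
    refine subsingleton_ext_one_of_forall_exists_extension
      (shortExact_cycles (i := k) (by simp) (hP.acyclic (k + 1))) ?_
    exact (homFromComplex_exactAt_iff_cycles Q (i := k - 1 - 1) (j := k - 1) (by simp) (by simp)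
      (hP.acyclic _) (hP.acyclic _)).1 (hP.hom_acyclic Q ‹_› _)
  | succ i ih =>
    have := hP.projective k
    have := Ext.subsingleton_of_projective (P.X k) Q (i + 1)
    have := ih (k - 1)
    rw [sub_add_cancel] at this
    exact (hP.isExtension_cycles k).subsingleton_ext_right Q (i + 1)

theorem isTotallyAcyclic_of_extProjectivesVanish_cycles (hproj : ∀ n, Projective (P.X n))
    (hP : P.Acyclic) (hZ : ∀ n, ExtProjectivesVanish (P.cycles n)) : IsTotallyAcyclic P where
  projective := hproj
  acyclic := hP
  hom_acyclic Q _ n := by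
    rw [homFromComplex_exactAt_iff_cycles Q (i := n - 1) (k := n + 1) (by simp) (by simp)
      (hP _) (hP _)]
    have := hZ (n + 1 + 1) Q 0
    exact exists_extension_of_subsingleton_ext (shortExact_cycles (by simp) (hP (n + 1 + 1)))

theorem exists_int_chain {α : Type*} {r : α → α → Prop} (hr : ∀ a, ∃ b, r a b)
    (hl : ∀ b, ∃ a, r a b) (a : α) : ∃ Z : ℤ → α, Z 0 = a ∧ ∀ n, r (Z n) (Z (n + 1)) := by
  choose next hnext using hr
  choose prev hprev using hl
  let Z : ℤ → α
    | .ofNat n => next^[n] a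
    | .negSucc n => prev^[n + 1] a
  refine ⟨Z, rfl, ?_⟩
  rintro (n | _ | n)
  · have := hnext (next^[n] a)
    rwa [← Function.iterate_succ_apply' next] at this
  · exact hprev a
  · have := hprev (prev^[n + 1] a)
    rwa [← Function.iterate_succ_apply' prev] at this

theorem isGorensteinProjective_iff : IsGorensteinProjective M ↔ gorensteinProjective M := by
  constructor
  · rintro ⟨P, hP, ⟨e⟩⟩
    refine gorensteinProjective.prop_of_iso e ?_
    refine IsCoresolving.le_gorensteinProjective (𝒳 := fun M => ∃ n, M = P.cycles n) ?_ _ ⟨0, rfl⟩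
    rintro _ ⟨n, rfl⟩
    exact ⟨hP.extProjectivesVanish_cycles n, P.X n, P.cycles (n + 1), hP.projective n,
      hP.isExtension_cycles n, n + 1, rfl⟩
  · intro hM
    obtain ⟨Z, hZ₀, hZ⟩ := exists_int_chain (α := Subtype (gorensteinProjective (C := ModuleCat A)))
      (r := fun X Y => ∃ P, Projective P ∧ IsExtension X.1 P Y.1)
      (fun ⟨X, hX⟩ =>
        let ⟨P, Y, hP, hXY, hY⟩ := hX.exists_isExtension
        ⟨⟨Y, hY⟩, P, hP, hXY⟩)
      (fun ⟨Y, hY⟩ =>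
        let ⟨X, P, hP, hXY⟩ := exists_isExtension_projective Y
        ⟨⟨X, hY.of_isExtension hXY⟩, P, hP, hXY⟩)
      ⟨M, hM⟩
    choose P hP hZP using hZ
    obtain ⟨X, rfl, hX, hXZ⟩ := exists_acyclic_of_isExtension hZP
    refine ⟨X, isTotallyAcyclic_of_extProjectivesVanish_cycles hP hX fun n => ?_, ?_⟩
    · obtain ⟨e⟩ := hXZ n
      exact (gorensteinProjective.prop_of_iso e.symm (Z n).2).extProjectivesVanish
    · have := hXZ 0
      rwa [hZ₀] at this

end TotallyAcyclic

section ChainComplexes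

variable {C : Type*} [Category* C] [Abelian C] {X : ChainComplex C ℕ} {M : C}

theorem isExtension_cycles (hX : X.Acyclic) (n : ℕ) :
    IsExtension (X.cycles (n + 1)) (X.X (n + 1)) (X.cycles n) :=
  isExtension_of_shortExact (shortExact_cycles (by simp) (hX n))

/-- In degree zero of a chain complex, everything is a cycle. -/
noncomputable def cyclesZeroIso (X : ChainComplex C ℕ) : X.cycles 0 ≅ X.X 0 :=
  X.iCyclesIso 0 0 (by simp) (X.shape _ _ (by simp))

theorem hasProjectiveDimensionLT_cycles (hX : X.Acyclic) (hproj : ∀ n, Projective (X.X (n + 1)))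
    (d : ℕ) [HasProjectiveDimensionLT (X.X 0) (d + 1)] (n : ℕ) :
    HasProjectiveDimensionLT (X.cycles n) (d + 1) := by
  induction n with
  | zero =>
    exact hasProjectiveDimensionLT_of_iso (cyclesZeroIso X).symm (d + 1)
  | succ n ih =>
    have := hproj n
    have := hasProjectiveDimensionLT_of_ge (X.X (n + 1)) 1 (d + 1) (by lia)
    have := hasProjectiveDimensionLT_of_ge (X.cycles n) (d + 1) (d + 1 + 1) (by lia)
    exact (isExtension_cycles hX n).hasProjectiveDimensionLT_left (d + 1)

theorem acyclic_augment_of_projectiveResolution (P : ProjectiveResolution M) :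
    (P.complex.augment (P.π.f 0) P.complex_d_comp_π_f_zero).Acyclic
  | 0 => by
    rw [HomologicalComplex.exactAt_iff' _ 1 0 0 (by simp) (by simp),
      ShortComplex.exact_iff_epi _ rfl]
    exact inferInstanceAs (Epi (P.π.f 0))
  | 1 => by
    rw [HomologicalComplex.exactAt_iff' _ 2 1 0 (by simp) (by simp)]
    exact ShortComplex.exact_of_g_is_cokernel _ P.isColimitCokernelCofork
  | n + 2 => by
    rw [HomologicalComplex.exactAt_iff' _ (n + 3) (n + 2) (n + 1) (by simp) (by simp)]
    exact P.exact_succ n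

end ChainComplexes

namespace ProperGPResolution

variable {A : Type v} [Ring A] {M : ModuleCat.{v} A} (G : ProperGPResolution M)
  (N : ModuleCat.{v} A)

/-- The augmented complex `⋯ ⟶ G₁ ⟶ G₀ ⟶ M` of a proper Gorenstein-projective resolution, with
`M` in degree `0`. -/
abbrev augmented : ChainComplex (ModuleCat.{v} A) ℕ :=
  G.complex.augment G.aug G.d_aug

theorem gorensteinProjective_X_succ (n : ℕ) :
    Gorenstein.gorensteinProjective (G.augmented.X (n + 1)) :=
  isGorensteinProjective_iff.1 (G.gorensteinProjective n)

theorem exists_lift_cycles {N : ModuleCat.{v} A} (hN : Gorenstein.gorensteinProjective N) {n : ℕ}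
    (φ : N ⟶ G.augmented.cycles n) :
    ∃ ψ : N ⟶ G.augmented.X (n + 1), ψ ≫ G.augmented.toCycles (n + 1) n = φ :=
  (homToComplex_exactAt_iff _ N (by simp)).1
    (G.proper N (isGorensteinProjective_iff.2 hN) n) φ

theorem subsingleton_gpExt_iff (n : ℕ) :
    Subsingleton (gpExt G N n) ↔ (homFromComplex G.complex N).ExactAt n := by
  rw [HomologicalComplex.exactAt_iff_isZero_homology]
  exact ⟨fun h => @AddCommGrpCat.isZero_of_subsingleton _ h, AddCommGrpCat.subsingleton_of_isZero⟩

instance : Epi G.aug := by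
  have h := G.acyclic 0
  rwa [HomologicalComplex.exactAt_iff' _ 1 0 0 (by simp) (by simp),
    ShortComplex.exact_iff_epi _ rfl] at h

theorem exact_d_aug : (ShortComplex.mk (G.complex.d 1 0) G.aug G.d_aug).Exact := by
  have h := G.acyclic 1
  rwa [HomologicalComplex.exactAt_iff' _ 2 1 0 (by simp) (by simp)] at h

theorem subsingleton_gpExt_zero_iff : Subsingleton (gpExt G N 0) ↔ ∀ φ : M ⟶ N, φ = 0 := by
  rw [G.subsingleton_gpExt_iff, homFromComplex_exactAt_iff G.complex N (i := 1) (k := 0)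
    (by simp) (by simp), G.complex.shape 0 0 (by simp)]
  refine ⟨fun h φ => ?_, fun h φ hφ => ⟨0, ?_⟩⟩
  · obtain ⟨ψ, hψ⟩ := h (G.aug ≫ φ) (by rw [reassoc_of% G.d_aug, zero_comp])
    rw [← cancel_epi G.aug, ← hψ, zero_comp, comp_zero]
  · have : Epi (ShortComplex.mk (G.complex.d 1 0) G.aug G.d_aug).g := inferInstanceAs (Epi G.aug)
    rw [← G.exact_d_aug.g_desc φ hφ, h (G.exact_d_aug.desc φ hφ), comp_zero, comp_zero]

theorem subsingleton_gpExt_succ_iff (n : ℕ) :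
    Subsingleton (gpExt G N (n + 1)) ↔ ∀ χ : G.augmented.cycles (n + 1) ⟶ N,
      ∃ ψ : G.augmented.X (n + 1) ⟶ N, G.augmented.iCycles (n + 1) ≫ ψ = χ := by
  rw [← homFromComplex_exactAt_iff_cycles N (i := n + 3) (j := n + 2) (by simp) (by simp)
      (G.acyclic _) (G.acyclic _),
    homFromComplex_exactAt_iff G.augmented N (i := n + 3) (k := n + 1) (by simp) (by simp),
    G.subsingleton_gpExt_iff, homFromComplex_exactAt_iff G.complex N (i := n + 2) (k := n)
      (by simp) (by simp)]
  rfl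

theorem gorensteinProjective_cycles (n : ℕ)
    (h : ∀ N, Subsingleton (gpExt G N (n + 1))) :
    Gorenstein.gorensteinProjective (G.augmented.cycles n) := by
  obtain ⟨r, hr⟩ := (G.subsingleton_gpExt_succ_iff _ n).1 (h _) (𝟙 _)
  have hS := shortExact_cycles (i := n + 1) (by simp) (G.acyclic n)
  have e := (ShortComplex.Splitting.ofExactOfRetraction _ hS.exact r hr hS.epi_g).isoBinaryBiproduct
  exact gorensteinProjective_of_biprod (Gorenstein.gorensteinProjective.prop_of_iso
    (e ≪≫ biprod.braiding _ _) (G.gorensteinProjective_X_succ n))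

theorem hasHull_cycles {m n : ℕ} (h : HasHull ⊤ (m + n + 1) M) :
    HasHull ⊤ (m + 1) (G.augmented.cycles n) := by
  induction n generalizing m with
  | zero => exact h.of_iso (cyclesZeroIso G.augmented).symm
  | succ n ih =>
    exact (ih (m := m + 1) (h.mono (by lia))).syzygy (isExtension_cycles G.acyclic n)
      (G.gorensteinProjective_X_succ n)

theorem hasHull_of_cycles {m n : ℕ} (h : HasHull ⊤ m (G.augmented.cycles n)) :
    HasHull ⊤ (m + n) M := by
  induction n generalizing m with
  | zero => exact h.of_iso (cyclesZeroIso G.augmented)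
  | succ n ih =>
    refine (ih (m := m + 1) ?_).mono (by lia)
    exact h.of_syzygy (fun _ _ hN => hasHull_one_iff.2 hN) (isExtension_cycles G.acyclic n)
      (G.gorensteinProjective_X_succ n) trivial

theorem subsingleton_gpExt_of_hasHull {n : ℕ} (h : HasHull ⊤ n M) :
    Subsingleton (gpExt G N n) := by
  cases n with
  | zero =>
    exact (G.subsingleton_gpExt_zero_iff N).2 fun φ => (hasHull_zero_iff.1 h).eq_of_src φ 0
  | succ n =>
    have hZ := hasHull_one_iff.1 (G.hasHull_cycles (h.mono (by lia : _ ≤ 0 + n + 1)))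
    obtain ⟨s, hs⟩ := G.exists_lift_cycles hZ (𝟙 _)
    have hS := shortExact_cycles (i := n + 1) (by simp) (G.acyclic n)
    let σ := ShortComplex.Splitting.ofExactOfSection _ hS.exact s hs hS.mono_f
    exact (G.subsingleton_gpExt_succ_iff N n).2 fun χ => ⟨σ.r ≫ χ, by rw [σ.f_r_assoc]⟩

theorem hasHull_of_subsingleton_gpExt {n : ℕ} (h : ∀ N, Subsingleton (gpExt G N n)) :
    HasHull ⊤ n M := by
  cases n with
  | zero =>
    exact hasHull_zero_iff.2 ((IsZero.iff_id_eq_zero M).2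
      ((G.subsingleton_gpExt_zero_iff M).1 (h M) _))
  | succ n =>
    exact (G.hasHull_of_cycles (hasHull_one_iff.2 (G.gorensteinProjective_cycles n h))).mono
      (by lia)

end ProperGPResolution

section GPDimension

theorem withBotENat_le_of_forall_lt {a b : WithBot ℕ∞} (h : ∀ n : ℕ, b < n → a < n) : a ≤ b := by
  induction b with
  | bot => exact ((WithBot.lt_zero_iff_eq_bot a).1 (h 0 (WithBot.bot_lt_coe _))).le
  | coe b =>
    induction b with
    | top => exact le_top
    | coe n => exact ENat.WithBot.lt_add_one_iff.1 (h (n + 1) (by exact_mod_cast n.lt_succ_self))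

variable {A : Type v} [Ring A] {M : ModuleCat.{v} A} {n : ℕ}

theorem gpDim_lt_iff : gpDim M < n ↔
    ∀ (G : ProperGPResolution M) (N : ModuleCat.{v} A) (i : ℕ), n ≤ i →
      Subsingleton (gpExt G N i) := by
  have h_lt : gpDim M < n ↔ ∀ (i : ℕ) (G : ProperGPResolution M) (N : ModuleCat.{v} A),
      Nontrivial (gpExt G N i) → i < n := by
    cases n with
    | zero =>
      rw [Nat.cast_zero, WithBot.lt_zero_iff_eq_bot, gpDim, sSup_eq_bot]
      refine ⟨fun h i G N hi => ?_, ?_⟩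
      · exact absurd (h i ⟨i, rfl, G, N, hi⟩) (by simp)
      · rintro h _ ⟨i, rfl, G, N, hi⟩
        exact absurd (h i G N hi) (by simp)
    | succ n =>
      rw [Nat.cast_add_one, ENat.WithBot.lt_add_one_iff, gpDim, sSup_le_iff]
      refine ⟨fun h i G N hi => ?_, ?_⟩
      · exact Nat.lt_succ_of_le (Nat.cast_le.1 (h i ⟨i, rfl, G, N, hi⟩))
      · rintro h _ ⟨i, rfl, G, N, hi⟩
        exact Nat.cast_le.2 (Nat.le_of_lt_succ (h i G N hi))
  simp only [h_lt, ← not_nontrivial_iff_subsingleton, ← not_lt]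
  grind

theorem ProperGPResolution.gpDim_lt_iff_hasHull (G : ProperGPResolution M) :
    gpDim M < n ↔ HasHull ⊤ n M :=
  gpDim_lt_iff.trans ⟨fun h => G.hasHull_of_subsingleton_gpExt fun N => h G N n le_rfl,
    fun h G' N _ hi => G'.subsingleton_gpExt_of_hasHull N (h.mono hi)⟩

theorem nonempty_properGPResolution_of_gpDim_ne_bot (h : gpDim M ≠ ⊥) :
    Nonempty (ProperGPResolution M) := by
  by_contra hM
  exact h ((WithBot.lt_zero_iff_eq_bot _).1 (gpDim_lt_iff.2 fun G => (hM ⟨G⟩).elim))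

theorem nonempty_properGPResolution_of_projectiveDimension_lt_top
    (h : projectiveDimension M < ⊤) : Nonempty (ProperGPResolution M) := by
  obtain ⟨d, hd⟩ := (projectiveDimension_ne_top_iff M).1 h.ne
  let P := ProjectiveResolution.of M
  let X := P.complex.augment (P.π.f 0) P.complex_d_comp_π_f_zero
  have hX : X.Acyclic := acyclic_augment_of_projectiveResolution P
  have : HasProjectiveDimensionLT (X.X 0) (d + 1) := hd
  refine ⟨P.complex, P.π.f 0, P.complex_d_comp_π_f_zero, fun n => ?_, hX, fun G hG n => ?_⟩
  · exact isGorensteinProjective_iff.2 (gorensteinProjective_of_projective _)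
  · have := hasProjectiveDimensionLT_cycles hX P.projective d (n + 1)
    have := (isGorensteinProjective_iff.1 hG).extProjectivesVanish.subsingleton_ext d
      (X.cycles (n + 1)) 0
    have hS := shortExact_cycles (i := n + 1) (by simp) (hX n)
    exact (homToComplex_exactAt_iff X G (i := n + 1) (by simp)).2
      (exists_lift_of_subsingleton_ext hS)

theorem gpDim_eq_projectiveDimension (h : projectiveDimension M < ⊤) :
    gpDim M = projectiveDimension M := by
  obtain ⟨G⟩ := nonempty_properGPResolution_of_projectiveDimension_lt_top h
  have h_lt (n : ℕ) : gpDim M < n ↔ projectiveDimension M < n := by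
    rw [G.gpDim_lt_iff_hasHull, projectiveDimension_lt_iff]
    exact ⟨fun hM => hM.hasProjectiveDimensionLT h,
      fun _ => hasHull_of_hasProjectiveDimensionLT trivial⟩
  exact le_antisymm (withBotENat_le_of_forall_lt fun n => (h_lt n).2)
    (withBotENat_le_of_forall_lt fun n => (h_lt n).1)

theorem exists_projectiveDimension_eq {𝓕 : ObjectProperty (ModuleCat.{v} A)}
    (h𝓕 : ∀ n, HasHull ⊤ n M → HasHull 𝓕 n M) (hn : gpDim M = n) :
    ∃ L, 𝓕 L ∧ projectiveDimension L = n := by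
  obtain ⟨G⟩ := nonempty_properGPResolution_of_gpDim_ne_bot (hn.trans_ne WithBot.coe_ne_bot)
  have h_lt : gpDim M < (n + 1 : ℕ) := hn ▸ by exact_mod_cast n.lt_succ_self
  obtain ⟨L, N, hML, hL, hN, hL𝓕⟩ := h𝓕 (n + 1) (G.gpDim_lt_iff_hasHull.1 h_lt)
  refine ⟨L, hL𝓕, le_antisymm ((projectiveDimension_le_iff L n).2 hL) (not_lt.1 fun hLn => ?_)⟩
  have hM : HasHull ⊤ n M := ⟨L, N, hML, (projectiveDimension_lt_iff).1 hLn, hN, trivial⟩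
  exact (G.gpDim_lt_iff_hasHull.2 hM).ne hn

theorem iSup_projectiveDimension_eq_iSup_gpDim {𝓕 : ObjectProperty (ModuleCat.{v} A)}
    (h𝓕 : ∀ n M, 𝓕 M → HasHull ⊤ n M → HasHull 𝓕 n M) :
    ⨆ (M) (_ : 𝓕 M) (_ : projectiveDimension M < ⊤), projectiveDimension M =
      ⨆ (M) (_ : 𝓕 M) (_ : gpDim M < ⊤), gpDim M := by
  refine le_antisymm (iSup_le fun M => iSup₂_le fun hM hfin => ?_)
    (iSup_le fun M => iSup₂_le fun hM hfin => ?_)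
  · have h := gpDim_eq_projectiveDimension hfin
    rw [← h] at hfin ⊢
    exact le_iSup_of_le M (le_iSup₂_of_le hM hfin le_rfl)
  · obtain h | ⟨n, hn⟩ : gpDim M = ⊥ ∨ ∃ n : ℕ, gpDim M = n := by
      generalize gpDim M = d at hfin
      induction d with
      | bot => exact .inl rfl
      | coe d =>
        obtain ⟨n, rfl⟩ := ENat.ne_top_iff_exists.1 (WithBot.coe_lt_coe.1 hfin).ne
        exact .inr ⟨n, rfl⟩
    · exact h ▸ bot_le
    · obtain ⟨L, hL, hLn⟩ := exists_projectiveDimension_eq (fun n => h𝓕 n M hM) hn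
      rw [hn, ← hLn] at hfin ⊢
      exact le_iSup_of_le L (le_iSup₂_of_le hL hfin le_rfl)

end GPDimension

section FinitelyGenerated

variable {A : Type v} [Ring A]

/- Such a map `ψ` factors through a free module of which `Q` is a retract, and only finitely many
of its coordinates there are nonzero. -/
theorem exists_extension_of_forall_dual {M F Q : Type*} [AddCommGroup M] [AddCommGroup F]
    [AddCommGroup Q] [Module A M] [Module A F] [Module A Q] [Module.Finite A M]
    [Module.Projective A Q] (Φ : M →ₗ[A] F)
    (hΦ : ∀ ψ : M →ₗ[A] A, ∃ χ : F →ₗ[A] A, χ ∘ₗ Φ = ψ) (ψ : M →ₗ[A] Q) :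
    ∃ χ : F →ₗ[A] Q, χ ∘ₗ Φ = ψ := by
  classical
  obtain ⟨s, hs⟩ := (Module.projective_def' (R := A) (P := Q)).1 inferInstance
  obtain ⟨S, hS⟩ := Module.Finite.fg_top (R := A) (M := M)
  let f : M →ₗ[A] (Q →₀ A) := s ∘ₗ ψ
  let T : Finset Q := S.biUnion fun x => (f x).support
  choose χ hχ using fun q => hΦ (Finsupp.lapply q ∘ₗ f)
  refine ⟨Finsupp.linearCombination A id ∘ₗ ∑ q ∈ T, Finsupp.lsingle q ∘ₗ χ q, ?_⟩
  have key : (∑ q ∈ T, Finsupp.lsingle q ∘ₗ χ q) ∘ₗ Φ = f := by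
    refine LinearMap.ext_on hS fun x hx => ?_
    have h₁ : ∀ q, χ q (Φ x) = f x q := fun q => LinearMap.congr_fun (hχ q) x
    have hsub : (f x).support ⊆ T := Finset.subset_biUnion_of_mem (fun x => (f x).support) hx
    simp only [LinearMap.comp_apply, LinearMap.sum_apply, h₁, Finsupp.lsingle_apply]
    conv_rhs => rw [← Finsupp.sum_single (f x)]
    rw [Finsupp.sum_of_support_subset _ hsub _ (by simp)]
  rw [LinearMap.comp_assoc, key, ← LinearMap.comp_assoc, hs, LinearMap.id_comp]

theorem isNoetherian_linearMap_of_finite {S M N : Type*} [Ring S] [AddCommGroup M]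
    [AddCommGroup N] [Module A M] [Module.Finite A M] [Module A N] [Module S N]
    [SMulCommClass A S N] [IsNoetherian S N] : IsNoetherian S (M →ₗ[A] N) := by
  obtain ⟨n, p, hp⟩ := Module.Finite.exists_fin' A M
  let e := (LinearMap.lsum A (fun _ : Fin n => A) S (M := N)).symm ≪≫ₗ
    LinearEquiv.piCongrRight fun _ => LinearMap.ringLmapEquivSelf A S N
  refine isNoetherian_of_injective (e.toLinearMap ∘ₗ p.lcomp S N) ?_
  exact e.injective.comp fun _ _ h => (LinearMap.cancel_right hp).1 h

theorem exists_linearMap_pi_extending_dual [IsNoetherian Aᵐᵒᵖ A] (M : Type*) [AddCommGroup M]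
    [Module A M] [Module.Finite A M] :
    ∃ (k : ℕ) (Φ : M →ₗ[A] (Fin k → A)),
      ∀ ψ : M →ₗ[A] A, ∃ χ : (Fin k → A) →ₗ[A] A, χ ∘ₗ Φ = ψ := by
  have : IsNoetherian Aᵐᵒᵖ (M →ₗ[A] A) := isNoetherian_linearMap_of_finite
  obtain ⟨k, φ, hφ⟩ := Module.Finite.exists_fin (R := Aᵐᵒᵖ) (M := M →ₗ[A] A)
  refine ⟨k, LinearMap.pi φ, fun ψ => ?_⟩
  have hψ : ψ ∈ Submodule.span Aᵐᵒᵖ (Set.range φ) := hφ ▸ Submodule.mem_top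
  obtain ⟨c, rfl⟩ := (Submodule.mem_span_range_iff_exists_fun Aᵐᵒᵖ).1 hψ
  exact ⟨∑ i, c i • LinearMap.proj i, by ext x; simp⟩

instance [IsNoetherianRing A] : (ModuleCat.isFG.{v} A).IsClosedUnderSubobjects where
  prop_of_mono f _ h :=
    have : Module.Finite A _ := h
    Module.Finite.of_injective f.hom ((ModuleCat.mono_iff_injective f).1 ‹_›)

instance : (ModuleCat.isFG.{v} A).IsClosedUnderQuotients where
  prop_of_epi f _ h :=
    have : Module.Finite A _ := h
    Module.Finite.of_surjective f.hom ((ModuleCat.epi_iff_surjective f).1 ‹_›)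

instance : (ModuleCat.isFG.{v} A).IsClosedUnderExtensions where
  prop_X₂_of_shortExact hS h₁ h₃ :=
    have : Module.Finite A _ := h₁
    have : Module.Finite A _ := h₃
    Module.Finite.of_exact
      ((ShortComplex.ShortExact.moduleCat_exact_iff_function_exact _).1 hS.exact)
      hS.moduleCat_surjective_g

theorem exists_isExtension_projective_isFG [IsNoetherianRing A] {M : ModuleCat.{v} A}
    (hM : ModuleCat.isFG A M) :
    ∃ K P, Projective P ∧ ModuleCat.isFG A P ∧ IsExtension K P M := by
  have : Module.Finite A M := hM
  obtain ⟨n, f, hf⟩ := Module.Finite.exists_fin' A M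
  let g : ModuleCat.of A (Fin n → A) ⟶ M := ModuleCat.ofHom f
  have : Epi g := (ModuleCat.epi_iff_surjective g).2 hf
  exact ⟨kernel g, _, ModuleCat.projective_of_free (Pi.basisFun A (Fin n)),
    inferInstanceAs (Module.Finite A (Fin n → A)), isExtension_kernel g⟩

theorem hasHull_one_isFG [IsNoetherian Aᵐᵒᵖ A] {M : ModuleCat.{v} A} (hM : ModuleCat.isFG A M)
    (hG : gorensteinProjective M) : HasHull (ModuleCat.isFG A) 1 M := by
  have : Module.Finite A M := hM
  obtain ⟨k, Φ, hΦ⟩ := exists_linearMap_pi_extending_dual (A := A) M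
  have : Projective (ModuleCat.of A (Fin k → A)) :=
    ModuleCat.projective_of_free (Pi.basisFun A (Fin k))
  obtain ⟨N, hMN, hN⟩ := hG.exists_isExtension_of_approximation (ModuleCat.ofHom Φ)
    fun Q _ φ => by
      obtain ⟨χ, hχ⟩ := exists_extension_of_forall_dual Φ hΦ φ.hom
      exact ⟨ModuleCat.ofHom χ, ModuleCat.hom_ext hχ⟩
  exact ⟨_, N, hMN, inferInstance, hN, inferInstanceAs (Module.Finite A (Fin k → A))⟩

end FinitelyGenerated

end Gorenstein

open Gorenstein in
/- `gpDim M = ⊥` when `M` has no proper Gorenstein-projective resolution, so over a general ring the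
Gorenstein-projective suprema run over the modules that have one. -/
theorem mainTheorem6_general (A : Type v) [Ring A] :
    bigFinDim A = bigFinGPDim A ∧
      (IsNoetherianRing A → IsNoetherian Aᵐᵒᵖ A → smallFinDim A = smallFinGPDim A) := by
  refine ⟨?_, fun _ _ => iSup_projectiveDimension_eq_iSup_gpDim (𝓕 := ModuleCat.isFG A)
    fun n M hM h => h.restrict (fun _ => exists_isExtension_projective_isFG)
      (fun _ => hasHull_one_isFG) hM⟩
  simpa [bigFinDim, bigFinGPDim] using
    iSup_projectiveDimension_eq_iSup_gpDim (A := A) (𝓕 := ⊤) fun _ _ _ h => h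

theorem mainTheorem6 (R : Type u) [CommRing R] [IsArtinianRing R]
    (A : Type v) [Ring A] [Algebra R A] [Module.Finite R A] :
    Gorenstein.bigFinDim A = Gorenstein.bigFinGPDim A ∧
      Gorenstein.smallFinDim A = Gorenstein.smallFinGPDim A := by
  obtain ⟨hbig, hsmall⟩ := mainTheorem6_general A
  exact ⟨hbig, hsmall (isNoetherian_of_tower R inferInstance)
    (isNoetherian_of_tower R inferInstance)⟩
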